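/- Let $M$ be a matroid of rank $k$ on a finite ground set $E$ with $|E|=n$, let $\mathbb{L}$ be a field, and let $S=\mathbb{L}[x_e : e\in E]$. For $U\subseteq E$ write $x^U=\prod_{u\in U}x_u$. Let $\Delta=\Delta(M)$ be the independence complex of $M$, and let $I_\Delta=\langle x^U : U\subseteq E \text{ dependent in } M\rangle\subseteq S$ be its Stanley–Reisner ideal. For an ideal $I\subseteq S$ and $s\ge 0$ let $I^{(s)}=\bigcap_{P\in\mathrm{Ass}(S/I)}(I^sS_P\cap S)$ be the $s$-th symbolic power, and let $\mathcal{R}_s(I)=\bigoplus_{i\ge 0}I^{(i)}T^i\subseteq S[T]$ be the symbolic Rees algebra. For $1\le i\le n-k$ let $M^{(i)}=\mathcal{E}^{i-1}(M)$ be the elongation of $M$ by rank $i-1$, that is, the matroid on $E$ whose independent sets are the sets $A\subseteq E$ with $|A|-\mathrm{rk}_M(A)\le i-1$. Let $M^*$ be the dual matroid, and for a flat $F$ of $M^*$ put $\mathrm{crk}_{M^*}(F)=\mathrm{rk}(M^*)-\mathrm{rk}_{M^*}(F)$. Then $\mathcal{R}_s(I_\Delta)$ is generated as an $S$-algebra by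 the set of monomials $$\{x^CT^i : C \text{ a circuit of } M^{(i)},\ 1\le i\le n-k\}.$$ Equivalently, $\mathcal{R}_s(I_\Delta)$ is generated as an $S$-algebra by $$\{x^{E\setminus F}T^{\mathrm{crk}_{M^*}(F)} : F \text{ a flat of } M^*,\ F\ne E\}.$$ -/

import Mathlib

/-! ## Elongation and corank of a matroid -/

namespace Matroid

/-- Independence in the elongation of `M` by rank `r`: the nullity `|A| - rk_M(A)` of `A` is at
most `r`. -/
def NullityLE {α : Type*} (M : Matroid α) (r : ℕ) (A : Set α) : Prop :=
  A ⊆ M.E ∧ A.encard ≤ M.eRk A + r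

theorem NullityLE.subset {α : Type*} {M : Matroid α} [M.Finite] {r : ℕ} {A B : Set α}
    (hB : M.NullityLE r B) (hAB : A ⊆ B) : M.NullityLE r A := by
  refine ⟨hAB.trans hB.1, ?_⟩
  have hfin : (B \ A).Finite := (M.ground_finite.subset hB.1).subset Set.sdiff_subset
  have h1 : M.eRk B ≤ M.eRk A + (B \ A).encard := by
    have := M.eRk_union_le_eRk_add_encard A (B \ A)
    rwa [Set.union_sdiff_cancel hAB] at this
  have h2 : (B \ A).encard + A.encard = B.encard := Set.encard_sdiff_add_encard_of_subset hAB
  have h3 : A.encard + (B \ A).encard ≤ (M.eRk A + r) + (B \ A).encard := by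
    calc A.encard + (B \ A).encard = B.encard := by rw [add_comm, h2]
      _ ≤ M.eRk B + r := hB.2
      _ ≤ (M.eRk A + (B \ A).encard) + r := by gcongr
      _ = (M.eRk A + r) + (B \ A).encard := by ring
  exact (ENat.add_le_add_iff_right hfin.encard_lt_top.ne).1 h3

theorem NullityLE.augment {α : Type*} {M : Matroid α} [M.Finite] {r : ℕ} {I J : Set α}
    (hI : M.NullityLE r I) (hJ : M.NullityLE r J) (hIJ : I.ncard < J.ncard) :
    ∃ e ∈ J, e ∉ I ∧ M.NullityLE r (insert e I) := by
  have hIfin : I.Finite := M.ground_finite.subset hI.1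
  have hJfin : J.Finite := M.ground_finite.subset hJ.1
  have hlt : I.encard < J.encard := by
    rw [← hIfin.cast_ncard_eq, ← hJfin.cast_ncard_eq]
    exact_mod_cast hIJ
  rcases hI.2.lt_or_eq with h | h
  · obtain ⟨e, heJ, heI⟩ := Set.exists_mem_notMem_of_ncard_lt_ncard hIJ hIfin
    refine ⟨e, heJ, heI, Set.insert_subset (hJ.1 heJ) hI.1, ?_⟩
    rw [Set.encard_insert_of_notMem heI]
    calc I.encard + 1 ≤ M.eRk I + r := Order.add_one_le_of_lt h
      _ ≤ M.eRk (insert e I) + r := by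
          gcongr
          exact M.eRk_mono (Set.subset_insert e I)
  · have hrk : M.eRk I < M.eRk J := by
      by_contra hcon
      have h4 : J.encard ≤ I.encard := by
        rw [h]
        exact hJ.2.trans (by gcongr; exact not_lt.1 hcon)
      exact absurd hlt (not_lt.2 h4)
    obtain ⟨e, he, heq⟩ := M.exists_eRk_insert_eq_add_one_of_lt hrk
    refine ⟨e, he.1, he.2, Set.insert_subset (hJ.1 he.1) hI.1, ?_⟩
    rw [Set.encard_insert_of_notMem he.2, heq, h]
    exact le_of_eq (by ring)

/-- The elongation `ℰ^r(M)` of a finite matroid `M` by rank `r`: the matroid on the ground set of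
`M` whose independent sets are the sets `A` with `|A| - rk_M(A) ≤ r`. -/
def elongation {α : Type*} (M : Matroid α) [M.Finite] (r : ℕ) : Matroid α :=
  (IndepMatroid.ofFinite M.ground_finite (M.NullityLE r)
    ⟨Set.empty_subset _, by simp⟩
    (fun _ _ hJ hIJ => hJ.subset hIJ)
    (fun _ _ hI hJ hIJ => hI.augment hJ hIJ)
    (fun _ hI => hI.1)).matroid

/-- The corank `crk_M(F) = rk(M) - rk_M(F)` of a set `F` in a matroid of finite rank. -/
noncomputable def corank {α : Type*} (M : Matroid α) (F : Set α) : ℕ :=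
  (M.eRank - M.eRk F).toNat

/-- The independence complex `Δ(M)`: its (nonempty) faces are the nonempty finite independent
sets of `M`. -/
def independenceComplex {α : Type*} (M : Matroid α) : PreAbstractSimplicialComplex α where
  faces := {U | U.Nonempty ∧ M.Indep (U : Set α)}
  isRelLowerSet_faces := fun _ hU =>
    ⟨hU.1, fun _ hV hVne => ⟨hVne, hU.2.subset (Finset.coe_subset.2 hV)⟩⟩

end Matroid

/-! ## Stanley-Reisner ideals -/

/-- The squarefree monomial `x^U = ∏_{u ∈ U} x_u`. -/
noncomputable def squarefreeMonomial (𝕃 : Type*) [Field 𝕃] {E : Type*} (U : Finset E) :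
    MvPolynomial E 𝕃 :=
  ∏ u ∈ U, MvPolynomial.X u

/-- The Stanley-Reisner ideal of a simplicial complex `Δ` on the vertex set `E`, generated by the
monomials `x^U` of the non-faces `U ⊆ E` of `Δ`. The empty set is always regarded as a face. -/
noncomputable def stanleyReisnerIdeal (𝕃 : Type*) [Field 𝕃] {E : Type*}
    (Δ : PreAbstractSimplicialComplex E) : Ideal (MvPolynomial E 𝕃) :=
  Ideal.span {m | ∃ U : Finset E, U.Nonempty ∧ U ∉ Δ.faces ∧ m = squarefreeMonomial 𝕃 U}

/-! ## Symbolic powers and the symbolic Rees algebra -/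

/-- The symbolic power `I^{(s)} = ⋂_{P ∈ Ass(R/I)} (I^s R_P ∩ R)`. -/
noncomputable def Ideal.symbolicPower {R : Type*} [CommRing R] (I : Ideal R) (s : ℕ) : Ideal R :=
  ⨅ P : associatedPrimes R (R ⧸ I),
    ((I ^ s).map (algebraMap R (Localization.AtPrime P.1))).comap
      (algebraMap R (Localization.AtPrime P.1))

theorem Ideal.symbolicPower_zero {R : Type*} [CommRing R] (I : Ideal R) :
    I.symbolicPower 0 = ⊤ := by
  simp [Ideal.symbolicPower, Ideal.one_eq_top, Ideal.map_top]

theorem Ideal.mul_mem_symbolicPower {R : Type*} [CommRing R] (I : Ideal R) {s t : ℕ} {a b : R}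
    (ha : a ∈ I.symbolicPower s) (hb : b ∈ I.symbolicPower t) :
    a * b ∈ I.symbolicPower (s + t) := by
  simp only [Ideal.symbolicPower, Ideal.mem_iInf, Ideal.mem_comap] at ha hb ⊢
  intro P
  rw [map_mul, pow_add, Ideal.map_mul]
  exact Ideal.mul_mem_mul (ha P) (hb P)

/-- The symbolic Rees algebra `ℛ_s(I) = ⨁_{i ≥ 0} I^{(i)} T^i`, as an `R`-subalgebra of `R[T]`:
the polynomials whose `i`-th coefficient lies in `I^{(i)}` for all `i`. -/
noncomputable def symbolicReesAlgebra {R : Type*} [CommRing R] (I : Ideal R) :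
    Subalgebra R (Polynomial R) where
  carrier := {f | ∀ i, f.coeff i ∈ I.symbolicPower i}
  mul_mem' := by
    intro f g hf hg i
    rw [Polynomial.coeff_mul]
    refine Ideal.sum_mem _ fun p hp => ?_
    rw [← Finset.HasAntidiagonal.mem_antidiagonal.1 hp]
    exact I.mul_mem_symbolicPower (hf p.1) (hg p.2)
  add_mem' := by
    intro f g hf hg i
    rw [Polynomial.coeff_add]
    exact Ideal.add_mem _ (hf i) (hg i)
  algebraMap_mem' := by
    intro r i
    rw [Polynomial.algebraMap_apply, Polynomial.coeff_C]
    split_ifs with h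
    · rw [h, I.symbolicPower_zero]
      exact Submodule.mem_top
    · exact Ideal.zero_mem _

/-! Write `I` for the Stanley–Reisner ideal and `P_B` for the prime generated by the variables
outside a base `B`. Each `P_B` is associated to `I`, and every associated prime lies in some `P_B`.
Hence each monomial `x^a` of an element of `I^{(s)}` has degree at least `s` outside every base
(`le_sum_of_mem_symbolicPower`).

Complements of bases of `M` are the bases of `M✶`, and a greedy one has `a`-weight equal to the sum
over `t` of the `M✶`-coranks of `F_t = {a ≤ t}` (`exists_isBase_sum_eq_sum_corank`). So `s` is at
most that sum. Since `x^a` is the product of the `x^{E ∖ F_t}`, the exponent `s` can be distributed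
as `j_t ≤ crk F_t`. Each `F_t` lies in a flat `G` of corank exactly `j_t`, and `x^{E ∖ G}` divides
`x^{E ∖ F_t}`. This yields the flat generators; nullity–corank duality turns them into circuits of
elongations (`elongation_isCircuit_iff`). -/

namespace Matroid

/-! ### Coranks, flats of the dual, and greedy bases -/

variable {α : Type*}

theorem corank_add_eRk (M : Matroid α) [M.RankFinite] (F : Set α) :
    (M.corank F : ℕ∞) + M.eRk F = M.eRank := by
  have h : M.eRank - M.eRk F ≠ ⊤ := ENat.sub_ne_top_iff.2 (Or.inl (M.eRank_ne_top_iff.2 ‹_›))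
  rw [corank, ENat.natCast_toNat h, tsub_add_cancel_of_le (M.eRk_le_eRank F)]

theorem eRk_ne_top (M : Matroid α) [M.RankFinite] (F : Set α) : M.eRk F ≠ ⊤ :=
  ne_top_of_le_ne_top (M.eRank_ne_top_iff.2 ‹_›) (M.eRk_le_eRank F)

theorem corank_ground (M : Matroid α) [M.RankFinite] : M.corank M.E = 0 := by
  simp [corank, eRk_ground]

theorem corank_le_iff (M : Matroid α) [M.RankFinite] {F : Set α} {r : ℕ} :
    M.corank F ≤ r ↔ M.eRank ≤ M.eRk F + r := by
  rw [← M.corank_add_eRk F, add_comm (M.eRk F), ENat.add_le_add_iff_right (M.eRk_ne_top F),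
    Nat.cast_le]

theorem corank_closure (M : Matroid α) (F : Set α) : M.corank (M.closure F) = M.corank F := by
  simp [corank]

/-- The nullity of `C` in `M` is the corank of the complement of `C` in `M✶`. -/
theorem eRk_add_corank_dual_compl (M : Matroid α) [M.Finite] {C : Set α} (hC : C ⊆ M.E) :
    M.eRk C + M✶.corank (M.E \ C) = C.encard := by
  have h1 := M.eRk_dual_add_eRank (M.E \ C)
  have h2 := M✶.corank_add_eRk (M.E \ C)
  have h3 := M.eRank_add_eRank_dual
  rw [Set.sdiff_sdiff_cancel_left hC] at h1
  rw [← Set.encard_sdiff_add_encard_of_subset hC, ← h2] at h3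
  have hfin : (M.E \ C).encard ≠ ⊤ := (M.ground_finite.subset Set.sdiff_subset).encard_lt_top.ne
  refine ENat.add_right_injective_of_ne_top hfin ?_
  dsimp only
  rw [← h3]
  calc _ = (M.eRk C + (M.E \ C).encard) + M✶.corank (M.E \ C) := by ring
    _ = _ := by rw [← h1]; ring

theorem elongation_ground (M : Matroid α) [M.Finite] (r : ℕ) : (M.elongation r).E = M.E := rfl

theorem elongation_indep_iff (M : Matroid α) [M.Finite] {r : ℕ} {A : Set α} :
    (M.elongation r).Indep A ↔ A ⊆ M.E ∧ M✶.corank (M.E \ A) ≤ r := by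
  have : (M.elongation r).Indep A ↔ A ⊆ M.E ∧ A.encard ≤ M.eRk A + r := Iff.rfl
  rw [this]
  refine and_congr_right fun hA => ?_
  rw [← M.eRk_add_corank_dual_compl hA, ENat.add_le_add_iff_left (M.eRk_ne_top A), Nat.cast_le]

theorem corank_le_corank_insert_add_one (M : Matroid α) [M.RankFinite] (e : α) (F : Set α) :
    M.corank F ≤ M.corank (insert e F) + 1 := by
  rw [corank_le_iff, ← M.corank_add_eRk (insert e F)]
  calc _ ≤ (M.corank (insert e F) : ℕ∞) + (M.eRk F + 1) := by
        gcongr; exact M.eRk_insert_le_add_one e F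
    _ = _ := by push_cast; ring

/-- Adding an element raises the rank exactly when it lies outside the closure. -/
theorem isFlat_iff_forall_corank_insert_lt (M : Matroid α) [M.RankFinite] {F : Set α}
    (hF : F ⊆ M.E) :
    M.IsFlat F ↔ ∀ e ∈ M.E \ F, M.corank (insert e F) < M.corank F := by
  constructor
  · intro h e he
    have h1 := M.eRk_insert_eq_add_one (e := e) (X := F) (by rwa [h.closure])
    have h2 := M.corank_add_eRk F
    rw [← M.corank_add_eRk (insert e F), h1] at h2
    have h3 : (M.corank F : ℕ∞) + M.eRk F = (M.corank (insert e F) + 1 : ℕ) + M.eRk F := by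
      rw [h2]; push_cast; ring
    replace h3 := ENat.add_left_injective_of_ne_top (M.eRk_ne_top F) h3
    rw [Nat.cast_inj] at h3
    omega
  · intro h
    rw [isFlat_iff_closure_eq]
    refine (M.subset_closure F hF).antisymm' fun e he => ?_
    by_contra heF
    have h1 := h e ⟨M.closure_subset_ground F he, heF⟩
    rw [← M.corank_closure (insert e F), closure_insert_eq_of_mem_closure he,
      corank_closure] at h1
    exact lt_irrefl _ h1

/-- The circuits of an elongation are the complements of the flats of the dual matroid. -/
theorem elongation_isCircuit_iff (M : Matroid α) [M.Finite] {r : ℕ} {C : Set α} (hC : C ⊆ M.E) :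
    (M.elongation r).IsCircuit C ↔
      M✶.IsFlat (M.E \ C) ∧ M✶.corank (M.E \ C) = r + 1 := by
  have hins : ∀ e ∈ C, M.E \ (C \ {e}) = insert e (M.E \ C) := by
    intro e he
    ext x
    have := hC he
    by_cases hx : x = e <;> simp [hx, this]
  have hsub : ∀ e, C \ {e} ⊆ M.E := fun e => Set.sdiff_subset.trans hC
  have hins' : (∀ e ∈ C, (M.elongation r).Indep (C \ {e})) ↔
      ∀ e ∈ C, M✶.corank (insert e (M.E \ C)) ≤ r := by
    refine forall₂_congr fun e he => ?_
    rw [elongation_indep_iff, and_iff_right (hsub e), hins e he]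
  rw [isCircuit_iff_dep_forall_sdiff_singleton_indep, hins',
    ← not_indep_iff (by rwa [elongation_ground]), elongation_indep_iff, and_iff_right hC, not_le,
    isFlat_iff_forall_corank_insert_lt M✶ (F := M.E \ C) Set.sdiff_subset, dual_ground,
    Set.sdiff_sdiff_cancel_left hC]
  constructor
  · rintro ⟨h1, h2⟩
    -- The empty set is excluded because the ground set has corank 0. Otherwise one insertion lowers
    -- the corank by at most one, which forces the value `r + 1`.
    obtain rfl | ⟨e, he⟩ := C.eq_empty_or_nonempty
    · have h0 := M✶.corank_ground
      rw [dual_ground] at h0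
      simp [h0] at h1
    · have h3 := M✶.corank_le_corank_insert_add_one e (M.E \ C)
      have h4 := h2 e he
      exact ⟨fun f hf => (h2 f hf).trans_lt h1, by omega⟩
  · rintro ⟨h1, h2⟩
    refine ⟨by omega, fun e he => ?_⟩
    have := h1 e he
    omega

/-- Every corank below that of `F` is attained by a flat containing `F`. -/
theorem exists_isFlat_superset_corank_eq (M : Matroid α) [M.RankFinite] {F : Set α}
    (hF : F ⊆ M.E) {j : ℕ} (hj : j ≤ M.corank F) :
    ∃ G, F ⊆ G ∧ M.IsFlat G ∧ M.corank G = j := by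
  obtain ⟨I, hI⟩ := M.exists_isBasis F
  obtain ⟨B, hB, hIB⟩ := hI.indep.exists_isBase_superset
  have h1 := M.corank_add_eRk F
  rw [← hB.encard_eq_eRank, ← Set.encard_sdiff_add_encard_of_subset hIB, hI.encard_eq_eRk] at h1
  replace h1 := ENat.add_left_injective_of_ne_top (M.eRk_ne_top F) h1
  -- `B ∖ I` has `M.corank F` elements. Removing `j` of them from `B` leaves an independent set of
  -- corank `j` that still spans `F`.
  obtain ⟨J, hJ, hJc⟩ := Set.exists_subset_encard_eq (s := B \ I) (k := j)
    (by rw [← h1]; exact_mod_cast hj)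
  have hIK : I ⊆ B \ J := fun x hx => ⟨hIB hx, fun hxJ => (hJ hxJ).2 hx⟩
  refine ⟨M.closure (B \ J), hI.subset_closure.trans (M.closure_subset_closure hIK),
    M.isFlat_closure _, ?_⟩
  have h2 := M.corank_add_eRk (B \ J)
  have hind := hB.indep.subset (Set.sdiff_subset (s := B) (t := J))
  rw [hind.eRk_eq_encard, ← hB.encard_eq_eRank,
    ← Set.encard_sdiff_add_encard_of_subset (hJ.trans Set.sdiff_subset), hJc] at h2
  have hne : (B \ J).encard ≠ ⊤ := hind.eRk_eq_encard ▸ M.eRk_ne_top _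
  rw [corank_closure]
  rw [add_comm] at h2
  exact Nat.cast_injective (ENat.add_right_injective_of_ne_top hne h2)

/-- `B ∩ F` is independent, so it has at most rank-of-`F` elements. This places the flat generators
in the symbolic Rees algebra. -/
theorem IsBase.corank_le_encard_sdiff {M : Matroid α} [M.RankFinite] {B : Set α}
    (hB : M.IsBase B) (F : Set α) : (M.corank F : ℕ∞) ≤ (B \ F).encard := by
  rw [← ENat.add_le_add_iff_right (M.eRk_ne_top F), corank_add_eRk, ← hB.encard_eq_eRank,
    ← Set.encard_sdiff_add_encard_inter B F]
  gcongr
  exact (hB.indep.subset Set.inter_subset_left).encard_le_eRk_of_subset Set.inter_subset_right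

/-- A base that is greedy for the weight `a` on the sublevel set of height `T`. -/
theorem exists_isBasis_sum_add_corank [Fintype α] (M : Matroid α)
    (hE : M.E = Set.univ) (a : α → ℕ) (T : ℕ) :
    ∃ I : Finset α, M.IsBasis (I : Set α) {e | a e < T} ∧
      ∑ e ∈ I, a e + T * M.corank {e | a e < T} =
        ∑ t ∈ Finset.range T, M.corank {e | a e < t + 1} := by
  classical
  induction T with
  | zero => exact ⟨∅, by simp⟩
  | succ T ih =>
    obtain ⟨I, hI, hsum⟩ := ih
    obtain ⟨J, hJ, hIJ⟩ := hI.indep.subset_isBasis_of_subset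
      (X := {e | a e < T + 1}) (hI.subset.trans fun e (he : a e < T) => Nat.lt_succ_of_lt he)
      (by rw [hE]; exact Set.subset_univ _)
    lift J to Finset α using J.toFinite
    rw [Finset.coe_subset] at hIJ
    refine ⟨J, hJ, ?_⟩
    -- A new element of weight below `T` could already have enlarged `I` inside the smaller sublevel
    -- set.
    have hval : ∀ e ∈ J \ I, a e = T := by
      intro e he
      rw [Finset.mem_sdiff] at he
      have h1 : a e < T + 1 := hJ.subset he.1
      by_contra hne
      have h2 : insert e (I : Set α) ⊆ {e | a e < T} :=
        Set.insert_subset (show a e < T by omega) hI.subset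
      have h3 : M.Indep (insert e (I : Set α)) :=
        hJ.indep.subset (Set.insert_subset he.1 (Finset.coe_subset.2 hIJ))
      exact he.2 (by simpa using (hI.mem_of_insert_indep (h2 (Set.mem_insert _ _)) h3))
    have hc1 := M.corank_add_eRk {e | a e < T}
    have hc2 := M.corank_add_eRk {e | a e < T + 1}
    rw [← hI.encard_eq_eRk, Set.encard_coe_eq_coe_finsetCard] at hc1
    rw [← hJ.encard_eq_eRk, Set.encard_coe_eq_coe_finsetCard, ← hc1] at hc2
    norm_cast at hc2
    have hcard := Finset.card_sdiff_add_card_eq_card hIJ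
    rw [Finset.sum_range_succ, ← hsum, ← Finset.sum_sdiff hIJ, Finset.sum_congr rfl hval,
      Finset.sum_const, smul_eq_mul]
    have hc3 : M.corank {e | a e < T} = M.corank {e | a e < T + 1} + (J \ I).card := by omega
    rw [hc3]
    ring

/-- Once `T` exceeds all weights, the sublevel set is the whole ground set and the correction term
`T * corank` vanishes. -/
theorem exists_isBase_sum_eq_sum_corank [Fintype α] (M : Matroid α)
    (hE : M.E = Set.univ) (a : α → ℕ) {T : ℕ} (hT : ∀ e, a e < T) :
    ∃ B : Finset α, M.IsBase (B : Set α) ∧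
      ∑ e ∈ B, a e = ∑ t ∈ Finset.range T, M.corank {e | a e < t + 1} := by
  obtain ⟨B, hB, h⟩ := M.exists_isBasis_sum_add_corank hE a T
  have huniv : {e | a e < T} = M.E := by
    rw [hE]; exact Set.eq_univ_of_forall hT
  rw [huniv] at hB
  rw [huniv, corank_ground, mul_zero, add_zero] at h
  exact ⟨B, by simpa using hB, h⟩

end Matroid

/-! ### Symbolic powers and associated primes elementwise -/

namespace Ideal

theorem mem_comap_map_atPrime_iff {R : Type*} [CommRing R] (I P : Ideal R) [P.IsPrime] (f : R) :
    f ∈ (I.map (algebraMap R (Localization.AtPrime P))).comap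
      (algebraMap R (Localization.AtPrime P)) ↔ ∃ u ∉ P, u * f ∈ I := by
  rw [mem_comap, IsLocalization.algebraMap_mem_map_algebraMap_iff P.primeCompl]
  rfl

theorem mem_symbolicPower_iff {R : Type*} [CommRing R] {I : Ideal R} {s : ℕ} {f : R} :
    f ∈ I.symbolicPower s ↔ ∀ P ∈ associatedPrimes R (R ⧸ I), ∃ u ∉ P, u * f ∈ I ^ s := by
  simp only [symbolicPower, mem_iInf, Subtype.forall]
  exact forall₂_congr fun P hP =>
    have : P.IsPrime := hP.1
    mem_comap_map_atPrime_iff (I ^ s) P f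

theorem mem_associatedPrimes_quotient_iff {R : Type*} [CommRing R] [IsNoetherianRing R]
    {I P : Ideal R} :
    P ∈ associatedPrimes R (R ⧸ I) ↔ P.IsPrime ∧ ∃ f, ∀ g, g ∈ P ↔ g * f ∈ I := by
  rw [AssociatedPrimes.mem_iff, isAssociatedPrime_iff]
  refine and_congr_right fun _ => ?_
  have key : ∀ f g : R, g ∈ (⊥ : Submodule R (R ⧸ I)).colon {Quotient.mk I f} ↔ g * f ∈ I := by
    intro f g
    rw [Submodule.mem_colon_singleton, Submodule.mem_bot, ← Quotient.eq_zero_iff_mem, map_mul]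
    rfl
  constructor
  · rintro ⟨x, rfl⟩
    obtain ⟨f, rfl⟩ := Quotient.mk_surjective x
    exact ⟨f, key f⟩
  · rintro ⟨f, hf⟩
    exact ⟨Quotient.mk I f, Ideal.ext fun g => by rw [hf, key]⟩

end Ideal

/-! ### The primes of the Stanley–Reisner ideal and its symbolic powers -/

section Monomials

variable {𝕃 : Type*} [Field 𝕃] {E : Type*}

theorem monomial_mem_of_squarefreeMonomial_support {I : Ideal (MvPolynomial E 𝕃)} {a : E →₀ ℕ}
    (ha : squarefreeMonomial 𝕃 a.support ∈ I) (c : 𝕃) : MvPolynomial.monomial a c ∈ I := by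
  rw [MvPolynomial.monomial_eq]
  refine I.mul_mem_left _ (I.mem_of_dvd ?_ ha)
  exact Finset.prod_dvd_prod_of_dvd _ _ fun e he =>
    dvd_pow_self _ (Finsupp.mem_support_iff.1 he)

theorem squarefreeMonomial_mem_stanleyReisnerIdeal (M : Matroid E) {U : Finset E}
    (hU : ¬ M.Indep (U : Set E)) :
    squarefreeMonomial 𝕃 U ∈ stanleyReisnerIdeal 𝕃 M.independenceComplex := by
  refine Ideal.subset_span ⟨U, ?_, fun h => hU h.2, rfl⟩
  rw [Finset.nonempty_iff_ne_empty]
  rintro rfl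
  simp at hU

variable [DecidableEq E]

/-- The substitution `x_e ↦ T x_e` for `e ∉ B` and `x_e ↦ x_e` for `e ∈ B`, which records the
degree in the variables outside `B`. -/
noncomputable def complDegreeHom (𝕃 : Type*) [Field 𝕃] (B : Finset E) :
    MvPolynomial E 𝕃 →ₐ[𝕃] Polynomial (MvPolynomial E 𝕃) :=
  MvPolynomial.aeval fun e =>
    if e ∈ B then Polynomial.C (MvPolynomial.X e) else Polynomial.X * Polynomial.C (MvPolynomial.X e)

theorem complDegreeHom_monomial (B : Finset E) (a : E →₀ ℕ) (c : 𝕃) :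
    complDegreeHom 𝕃 B (MvPolynomial.monomial a c) =
      Polynomial.monomial (∑ e ∈ a.support \ B, a e) (MvPolynomial.monomial a c) := by
  have h : ∀ e, (if e ∈ B then Polynomial.C (MvPolynomial.X e : MvPolynomial E 𝕃)
      else Polynomial.X * Polynomial.C (MvPolynomial.X e)) ^ a e =
      Polynomial.X ^ (if e ∈ B then 0 else a e) * Polynomial.C (MvPolynomial.X e ^ a e) := by
    intro e
    split_ifs
    · simp
    · rw [mul_pow, map_pow]
  have hsum : ∑ e ∈ a.support, (if e ∈ B then 0 else a e) = ∑ e ∈ a.support \ B, a e := by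
    rw [Finset.sdiff_eq_filter, Finset.sum_filter]
    exact Finset.sum_congr rfl fun e _ => by split_ifs <;> rfl
  rw [complDegreeHom, MvPolynomial.aeval_monomial, Finsupp.prod, Finset.prod_congr rfl fun e _ => h e,
    Finset.prod_mul_distrib, Finset.prod_pow_eq_pow_sum, ← map_prod, hsum,
    MvPolynomial.monomial_eq, ← Polynomial.C_mul_X_pow_eq_monomial,
    Polynomial.C_mul, Finsupp.prod]
  rw [show algebraMap 𝕃 (Polynomial (MvPolynomial E 𝕃)) c = Polynomial.C (MvPolynomial.C c) from rfl]
  ring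

theorem coeff_coeff_complDegreeHom (B : Finset E) (f : MvPolynomial E 𝕃) (a : E →₀ ℕ) (j : ℕ) :
    ((complDegreeHom 𝕃 B f).coeff j).coeff a =
      if ∑ e ∈ a.support \ B, a e = j then f.coeff a else 0 := by
  induction f using MvPolynomial.induction_on' with
  | monomial b c =>
    rw [complDegreeHom_monomial, Polynomial.coeff_monomial]
    by_cases hab : b = a
    · subst hab
      split_ifs <;> simp
    · split_ifs <;> simp [MvPolynomial.coeff_monomial, hab]
  | add p q hp hq =>
    rw [map_add, Polynomial.coeff_add, MvPolynomial.coeff_add, hp, hq, MvPolynomial.coeff_add]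
    split_ifs <;> simp

/-- The prime ideal `P_B = ⟨x_e : e ∉ B⟩`. -/
noncomputable def complVariablesIdeal (𝕃 : Type*) [Field 𝕃] (B : Finset E) :
    Ideal (MvPolynomial E 𝕃) :=
  (Ideal.span {(Polynomial.X : Polynomial (MvPolynomial E 𝕃))}).comap (complDegreeHom 𝕃 B)

theorem mem_complVariablesIdeal_iff {B : Finset E} {f : MvPolynomial E 𝕃} :
    f ∈ complVariablesIdeal 𝕃 B ↔ Polynomial.X ∣ complDegreeHom 𝕃 B f := by
  rw [complVariablesIdeal, Ideal.mem_comap, Ideal.mem_span_singleton]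

/-- Defining `P_B` as the preimage of the prime `⟨T⟩` gives primality at once. -/
instance complVariablesIdeal_isPrime (B : Finset E) : (complVariablesIdeal 𝕃 B).IsPrime := by
  have : (Ideal.span {(Polynomial.X : Polynomial (MvPolynomial E 𝕃))}).IsPrime :=
    (Ideal.span_singleton_prime Polynomial.X_ne_zero).2 Polynomial.prime_X
  exact Ideal.comap_isPrime _ _

theorem X_mem_complVariablesIdeal {B : Finset E} {e : E} (he : e ∉ B) :
    (MvPolynomial.X e : MvPolynomial E 𝕃) ∈ complVariablesIdeal 𝕃 B := by
  simp [mem_complVariablesIdeal_iff, complDegreeHom, he]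

theorem coeff_eq_zero_of_mem_complVariablesIdeal {B : Finset E} {f : MvPolynomial E 𝕃}
    (hf : f ∈ complVariablesIdeal 𝕃 B) {a : E →₀ ℕ} (ha : a.support ⊆ B) : f.coeff a = 0 := by
  rw [mem_complVariablesIdeal_iff, Polynomial.X_dvd_iff] at hf
  have h := coeff_coeff_complDegreeHom B f a 0
  rw [hf, Finset.sdiff_eq_empty_iff_subset.2 ha] at h
  simpa using h.symm

theorem squarefreeMonomial_notMem_complVariablesIdeal (B : Finset E) :
    squarefreeMonomial 𝕃 B ∉ complVariablesIdeal 𝕃 B := by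
  rw [squarefreeMonomial, Ideal.IsPrime.prod_mem_iff]
  rintro ⟨e, he, hmem⟩
  have := coeff_eq_zero_of_mem_complVariablesIdeal hmem (a := Finsupp.single e 1)
    (Finsupp.support_single_subset.trans (by simpa using he))
  simp at this

theorem le_sum_of_mul_mem_pow {I : Ideal (MvPolynomial E 𝕃)} {B : Finset E}
    (hI : I ≤ complVariablesIdeal 𝕃 B) {u f : MvPolynomial E 𝕃} {s : ℕ}
    (hu : u ∉ complVariablesIdeal 𝕃 B) (huf : u * f ∈ I ^ s) {a : E →₀ ℕ} (ha : f.coeff a ≠ 0) :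
    s ≤ ∑ e ∈ a.support \ B, a e := by
  have h1 : complDegreeHom 𝕃 B (u * f) ∈
      Ideal.span {(Polynomial.X : Polynomial (MvPolynomial E 𝕃))} ^ s :=
    Ideal.le_comap_pow _ s (Ideal.pow_right_mono hI s huf)
  rw [Ideal.span_singleton_pow, Ideal.mem_span_singleton, map_mul] at h1
  -- `T` is prime and does not divide the image of `u`, so all of `T ^ s` divides the image of `f`.
  have h2 := Polynomial.prime_X.pow_dvd_of_dvd_mul_left s
    (fun h => hu (mem_complVariablesIdeal_iff.2 h)) h1
  by_contra hlt
  have h3 := coeff_coeff_complDegreeHom B f a (∑ e ∈ a.support \ B, a e)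
  rw [if_pos rfl, Polynomial.X_pow_dvd_iff.1 h2 _ (not_le.1 hlt), MvPolynomial.coeff_zero] at h3
  exact ha h3.symm

theorem stanleyReisnerIdeal_le_complVariablesIdeal {M : Matroid E} {B : Finset E}
    (hB : M.Indep (B : Set E)) :
    stanleyReisnerIdeal 𝕃 M.independenceComplex ≤ complVariablesIdeal 𝕃 B := by
  rw [stanleyReisnerIdeal, Ideal.span_le]
  rintro _ ⟨U, hU, hUf, rfl⟩
  obtain ⟨e, heU, heB⟩ : ∃ e ∈ U, e ∉ B := by
    by_contra! h
    exact hUf ⟨hU, hB.subset (Finset.coe_subset.2 h)⟩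
  exact Ideal.mem_of_dvd _ (Finset.dvd_prod_of_mem _ heU) (X_mem_complVariablesIdeal heB)

theorem X_mul_squarefreeMonomial_mem {M : Matroid E} {B : Finset E} (hB : M.IsBase (B : Set E))
    {e : E} (he : e ∉ B) : MvPolynomial.X e * squarefreeMonomial 𝕃 B ∈
      stanleyReisnerIdeal 𝕃 M.independenceComplex := by
  have h : squarefreeMonomial 𝕃 (insert e B) = MvPolynomial.X e * squarefreeMonomial 𝕃 B :=
    Finset.prod_insert he
  rw [← h]
  refine squarefreeMonomial_mem_stanleyReisnerIdeal M fun hind => he ?_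
  have := hB.eq_of_subset_indep hind (by simp)
  rw [Finset.coe_inj] at this
  rw [this]
  exact Finset.mem_insert_self e B

theorem mul_squarefreeMonomial_mem {M : Matroid E} {B : Finset E} (hB : M.IsBase (B : Set E))
    {f : MvPolynomial E 𝕃} (hf : f ∈ complVariablesIdeal 𝕃 B) :
    f * squarefreeMonomial 𝕃 B ∈ stanleyReisnerIdeal 𝕃 M.independenceComplex := by
  rw [f.as_sum, Finset.sum_mul]
  refine Ideal.sum_mem _ fun a ha => ?_
  obtain ⟨e, hea, heB⟩ : ∃ e ∈ a.support, e ∉ B := by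
    by_contra! h
    exact MvPolynomial.mem_support_iff.1 ha (coeff_eq_zero_of_mem_complVariablesIdeal hf h)
  refine Ideal.mem_of_dvd _ (mul_dvd_mul_right ?_ _) (X_mul_squarefreeMonomial_mem hB heB)
  rw [MvPolynomial.monomial_eq]
  exact ((dvd_pow_self _ (Finsupp.mem_support_iff.1 hea)).trans
    (Finset.dvd_prod_of_mem (fun i => (MvPolynomial.X i : MvPolynomial E 𝕃) ^ a i) hea)).mul_left _

/-- `P_B` is the annihilator of the class of `x^B`, since adding any element to a base makes it
dependent. -/
theorem complVariablesIdeal_mem_associatedPrimes [Finite E] {M : Matroid E} {B : Finset E}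
    (hB : M.IsBase (B : Set E)) : complVariablesIdeal 𝕃 B ∈ associatedPrimes (MvPolynomial E 𝕃)
      (MvPolynomial E 𝕃 ⧸ stanleyReisnerIdeal 𝕃 M.independenceComplex) := by
  rw [Ideal.mem_associatedPrimes_quotient_iff]
  refine ⟨inferInstance, squarefreeMonomial 𝕃 B, fun g => ⟨mul_squarefreeMonomial_mem hB, ?_⟩⟩
  intro h
  exact ((complVariablesIdeal_isPrime B).mem_or_mem
    (stanleyReisnerIdeal_le_complVariablesIdeal hB.indep h)).resolve_right
    (squarefreeMonomial_notMem_complVariablesIdeal B)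

/-- If `P` is the annihilator of the class of `f ∉ I`, some monomial of `f` has independent support.
A base `B` containing it gives `f ∉ P_B`, while `P f ⊆ I ⊆ P_B`. -/
theorem exists_le_complVariablesIdeal_of_mem_associatedPrimes [Finite E] {M : Matroid E}
    {P : Ideal (MvPolynomial E 𝕃)} (hP : P ∈ associatedPrimes (MvPolynomial E 𝕃)
      (MvPolynomial E 𝕃 ⧸ stanleyReisnerIdeal 𝕃 M.independenceComplex)) :
    ∃ B : Finset E, M.IsBase (B : Set E) ∧ P ≤ complVariablesIdeal 𝕃 B := by
  rw [Ideal.mem_associatedPrimes_quotient_iff] at hP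
  obtain ⟨hPp, f, hf⟩ := hP
  have hfI : f ∉ stanleyReisnerIdeal 𝕃 M.independenceComplex := fun h =>
    hPp.ne_top (P.eq_top_iff_one.2 ((hf 1).2 (by rwa [one_mul])))
  obtain ⟨a, ha, haI⟩ : ∃ a ∈ f.support, M.Indep (a.support : Set E) := by
    by_contra! h
    refine hfI (f.as_sum ▸ Ideal.sum_mem _ fun a ha => ?_)
    exact monomial_mem_of_squarefreeMonomial_support
      (squarefreeMonomial_mem_stanleyReisnerIdeal M (h a ha)) _
  obtain ⟨B, hB, haB⟩ := haI.exists_isBase_superset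
  lift B to Finset E using B.toFinite
  refine ⟨B, hB, fun g hg => ?_⟩
  refine ((complVariablesIdeal_isPrime B).mem_or_mem
    (stanleyReisnerIdeal_le_complVariablesIdeal hB.indep ((hf g).1 hg))).resolve_right fun h => ?_
  exact MvPolynomial.mem_support_iff.1 ha
    (coeff_eq_zero_of_mem_complVariablesIdeal h (Finset.coe_subset.1 haB))

theorem le_sum_of_mem_symbolicPower [Finite E] {M : Matroid E} {s : ℕ} {f : MvPolynomial E 𝕃}
    (hf : f ∈ (stanleyReisnerIdeal 𝕃 M.independenceComplex).symbolicPower s) {a : E →₀ ℕ}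
    (ha : f.coeff a ≠ 0) {B : Finset E} (hB : M.IsBase (B : Set E)) :
    s ≤ ∑ e ∈ a.support \ B, a e := by
  obtain ⟨u, hu, huf⟩ := Ideal.mem_symbolicPower_iff.1 hf _
    (complVariablesIdeal_mem_associatedPrimes hB)
  exact le_sum_of_mul_mem_pow (stanleyReisnerIdeal_le_complVariablesIdeal hB.indep) hu huf ha

theorem squarefreeMonomial_mem_symbolicPower [Finite E] {M : Matroid E} {s : ℕ} {U : Finset E}
    (hU : ∀ B : Finset E, M.IsBase (B : Set E) → s ≤ (U \ B).card) : squarefreeMonomial 𝕃 U ∈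
      (stanleyReisnerIdeal 𝕃 M.independenceComplex).symbolicPower s := by
  rw [Ideal.mem_symbolicPower_iff]
  intro P hP
  obtain ⟨B, hB, hPB⟩ := exists_le_complVariablesIdeal_of_mem_associatedPrimes hP
  -- One factor `x^B` for each `e ∈ U ∖ B`: every product `x_e x^B` lies in `I`.
  refine ⟨squarefreeMonomial 𝕃 B ^ (U \ B).card, fun h => ?_, ?_⟩
  · exact squarefreeMonomial_notMem_complVariablesIdeal B
      ((complVariablesIdeal_isPrime B).mem_of_pow_mem _ (hPB h))
  · refine Ideal.pow_le_pow_right (hU B hB) ?_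
    have h1 : squarefreeMonomial 𝕃 U =
        squarefreeMonomial 𝕃 (U \ B) * squarefreeMonomial 𝕃 (U ∩ B) := by
      rw [mul_comm]
      exact (Finset.prod_inter_mul_prod_sdiff U B _).symm
    have h2 : squarefreeMonomial 𝕃 B ^ (U \ B).card * squarefreeMonomial 𝕃 (U \ B) =
        ∏ e ∈ U \ B, (MvPolynomial.X e * squarefreeMonomial 𝕃 B) := by
      rw [Finset.prod_mul_distrib, Finset.prod_const, mul_comm]
      rfl
    rw [h1, ← mul_assoc, h2]
    refine Ideal.mul_mem_right _ _ ?_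
    rw [← Finset.prod_const]
    exact Ideal.prod_mem_prod fun e he =>
      X_mul_squarefreeMonomial_mem hB (Finset.mem_sdiff.1 he).2

end Monomials

/-! ### Generators of the symbolic Rees algebra -/

section SymbolicRees

variable {𝕃 : Type*} [Field 𝕃] {E : Type*}

/-- The powers of `T` that `m` carries in a subalgebra `A` of `R[T]` add up under
multiplication. -/
theorem monomial_prod_mem_of_le_sum {R ι : Type*} [CommRing R] (A : Subalgebra R (Polynomial R))
    (S : Finset ι) (m : ι → R) (c : ι → ℕ)
    (h : ∀ i ∈ S, ∀ j ≤ c i, Polynomial.monomial j (m i) ∈ A) :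
    ∀ j ≤ ∑ i ∈ S, c i, Polynomial.monomial j (∏ i ∈ S, m i) ∈ A := by
  classical
  induction S using Finset.induction_on with
  | empty =>
    intro j hj
    obtain rfl : j = 0 := by simpa using hj
    exact A.algebraMap_mem _
  | insert i S hi ih =>
    intro j hj
    rw [Finset.sum_insert hi] at hj
    -- The factor `m i` takes as much of the exponent as it can carry; the rest goes to the other
    -- factors.
    rw [Finset.prod_insert hi, show j = min j (c i) + (j - min j (c i)) by omega,
      ← Polynomial.monomial_mul_monomial]
    exact A.mul_mem (h i (Finset.mem_insert_self i S) _ (min_le_right _ _))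
      (ih (fun k hk => h k (Finset.mem_insert_of_mem hk)) _ (by omega))

theorem monomial_mem_of_dvd {R : Type*} [CommRing R] (A : Subalgebra R (Polynomial R)) {j : ℕ}
    {m m' : R} (hm : Polynomial.monomial j m ∈ A) (h : m ∣ m') :
    Polynomial.monomial j m' ∈ A := by
  obtain ⟨r, rfl⟩ := h
  rw [mul_comm, ← smul_eq_mul, ← Polynomial.smul_monomial]
  exact A.smul_mem hm r

/-- A monomial is the product of the squarefree monomials of its superlevel sets. -/
theorem monomial_eq_prod_squarefreeMonomial [Fintype E] (a : E →₀ ℕ) {T : ℕ}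
    (hT : ∀ e, a e < T) : MvPolynomial.monomial a (1 : 𝕃) =
      ∏ t ∈ Finset.range T, squarefreeMonomial 𝕃 (Finset.univ.filter fun e => t + 1 ≤ a e) := by
  simp only [squarefreeMonomial]
  rw [MvPolynomial.monomial_eq, map_one, one_mul, Finsupp.prod_fintype _ _ fun _ => pow_zero _]
  simp_rw [Finset.prod_filter]
  rw [Finset.prod_comm]
  refine Finset.prod_congr rfl fun e _ => ?_
  rw [← Finset.prod_filter, Finset.prod_const]
  congr 1
  rw [show (Finset.range T).filter (fun t => t + 1 ≤ a e) = Finset.range (a e) by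
    ext t
    have := hT e
    simp only [Finset.mem_filter, Finset.mem_range]
    omega, Finset.card_range]

variable [Fintype E] [DecidableEq E]

/-- The generators `x^{E ∖ F} T^{crk F}` attached to the proper flats of the dual matroid. -/
def dualFlatMonomials (𝕃 : Type*) [Field 𝕃] (M : Matroid E) :
    Set (Polynomial (MvPolynomial E 𝕃)) :=
  {f | ∃ F : Finset E, M✶.IsFlat (F : Set E) ∧ F ≠ Finset.univ ∧
    f = Polynomial.monomial (M✶.corank (F : Set E)) (squarefreeMonomial 𝕃 Fᶜ)}

theorem monomial_squarefreeMonomial_mem_adjoin {M : Matroid E} (hE : M.E = Set.univ)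
    (F : Finset E) {j : ℕ} (hj : j ≤ M✶.corank (F : Set E)) :
    Polynomial.monomial j (squarefreeMonomial 𝕃 Fᶜ) ∈
      Algebra.adjoin (MvPolynomial E 𝕃) (dualFlatMonomials 𝕃 M) := by
  -- Exponent 0 is treated apart: the flat of corank 0 is the ground set, which is not among the
  -- generators.
  obtain rfl | hj0 := Nat.eq_zero_or_pos j
  · exact Subalgebra.algebraMap_mem _ _
  obtain ⟨G, hFG, hG, rfl⟩ := M✶.exists_isFlat_superset_corank_eq
    (by rw [Matroid.dual_ground, hE]; exact Set.subset_univ _) hj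
  lift G to Finset E using G.toFinite
  refine monomial_mem_of_dvd _ (Algebra.subset_adjoin ⟨G, hG, ?_, rfl⟩)
    (Finset.prod_dvd_prod_of_subset _ _ _ (Finset.compl_subset_compl.2 (Finset.coe_subset.1 hFG)))
  rintro rfl
  have h0 := M✶.corank_ground
  rw [Matroid.dual_ground, hE] at h0
  rw [Finset.coe_univ] at hj0
  omega

theorem monomial_monomial_mem_adjoin {M : Matroid E} (hE : M.E = Set.univ) {s : ℕ} {a : E →₀ ℕ}
    (ha : ∀ B : Finset E, M.IsBase (B : Set E) → s ≤ ∑ e ∈ a.support \ B, a e) (c : 𝕃) :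
    Polynomial.monomial s (MvPolynomial.monomial a c) ∈
      Algebra.adjoin (MvPolynomial E 𝕃) (dualFlatMonomials 𝕃 M) := by
  obtain ⟨T, hT⟩ : ∃ T, ∀ e, a e < T :=
    ⟨Finset.univ.sup a + 1, fun e => Nat.lt_succ_of_le (Finset.le_sup (Finset.mem_univ e))⟩
  obtain ⟨B, hB, hsum⟩ := M✶.exists_isBase_sum_eq_sum_corank (by rwa [Matroid.dual_ground]) a hT
  have hs : s ≤ ∑ t ∈ Finset.range T, M✶.corank {e | a e < t + 1} := by
    -- Testing the hypothesis on the complement of the greedy dual base bounds `s` by the weight of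
    -- that base.
    have hBc := hB.compl_isBase_of_dual
    rw [hE, ← Set.compl_eq_univ_sdiff, ← Finset.coe_compl] at hBc
    rw [← hsum]
    refine (ha _ hBc).trans (Finset.sum_le_sum_of_subset ?_)
    intro e he
    simpa using (Finset.mem_sdiff.1 he).2
  refine monomial_mem_of_dvd _ (m := MvPolynomial.monomial a 1) ?_
    ⟨MvPolynomial.C c, by rw [mul_comm, MvPolynomial.C_mul_monomial, mul_one]⟩
  rw [monomial_eq_prod_squarefreeMonomial a hT]
  refine monomial_prod_mem_of_le_sum _ _ _ _ (fun t _ j hj => ?_) s hs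
  have h := monomial_squarefreeMonomial_mem_adjoin (𝕃 := 𝕃) hE
    (Finset.univ.filter fun e => a e < t + 1) (j := j) (by simpa using hj)
  convert h using 3
  ext e
  simp

theorem symbolicReesAlgebra_eq_adjoin_dualFlatMonomials {M : Matroid E} (hE : M.E = Set.univ) :
    symbolicReesAlgebra (stanleyReisnerIdeal 𝕃 M.independenceComplex) =
      Algebra.adjoin (MvPolynomial E 𝕃) (dualFlatMonomials 𝕃 M) := by
  refine le_antisymm (fun f hf => ?_) (Algebra.adjoin_le ?_)
  · rw [f.as_sum_support]
    refine Subalgebra.sum_mem _ fun s _ => ?_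
    rw [(f.coeff s).as_sum, map_sum]
    refine Subalgebra.sum_mem _ fun a ha => ?_
    exact monomial_monomial_mem_adjoin hE (fun B hB =>
      le_sum_of_mem_symbolicPower (hf s) (MvPolynomial.mem_support_iff.1 ha) hB) _
  · rintro _ ⟨F, -, -, rfl⟩ i
    rw [Polynomial.coeff_monomial]
    split_ifs with h
    · subst h
      refine squarefreeMonomial_mem_symbolicPower fun B hB => ?_
      have h1 := hB.compl_isBase_dual.corank_le_encard_sdiff (F : Set E)
      have h2 : (M.E \ B) \ F = ((Fᶜ \ B : Finset E) : Set E) := by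
        ext e
        simp [hE, and_comm]
      rw [h2, Set.encard_coe_eq_coe_finsetCard] at h1
      exact_mod_cast h1
    · exact Ideal.zero_mem _

theorem setOf_elongation_circuit_monomials_eq {M : Matroid E} (hE : M.E = Set.univ) {n k : ℕ}
    (hn : Fintype.card E = n) (hk : M.eRank = (k : ℕ∞)) :
    {f : Polynomial (MvPolynomial E 𝕃) | ∃ (i : ℕ) (C : Finset E),
      1 ≤ i ∧ i ≤ n - k ∧ (M.elongation (i - 1)).IsCircuit (C : Set E) ∧
        f = Polynomial.monomial i (squarefreeMonomial 𝕃 C)} = dualFlatMonomials 𝕃 M := by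
  have hcompl : ∀ C : Finset E, M.E \ C = ((Cᶜ : Finset E) : Set E) := fun C => by
    rw [hE, Finset.coe_compl, Set.compl_eq_univ_sdiff]
  have hcirc : ∀ (r : ℕ) (C : Finset E), (M.elongation r).IsCircuit (C : Set E) ↔
      M✶.IsFlat ((Cᶜ : Finset E) : Set E) ∧ M✶.corank ((Cᶜ : Finset E) : Set E) = r + 1 := by
    intro r C
    rw [M.elongation_isCircuit_iff (by rw [hE]; exact Set.subset_univ _), hcompl]
  have h0 := M✶.corank_ground
  rw [Matroid.dual_ground, hE] at h0
  ext f
  constructor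
  · rintro ⟨i, C, hi, -, hC, rfl⟩
    rw [hcirc, Nat.sub_add_cancel hi] at hC
    refine ⟨Cᶜ, hC.1, ?_, by rw [hC.2, compl_compl]⟩
    intro h
    rw [h, Finset.coe_univ, h0] at hC
    omega
  · rintro ⟨F, hF, hFE, rfl⟩
    -- A proper flat loses corank when an outside element is added, so its corank is positive and
    -- can be written `(i - 1) + 1`.
    have hpos : 1 ≤ M✶.corank (F : Set E) := by
      obtain ⟨e, he⟩ : ∃ e, e ∉ F := by
        by_contra! h
        exact hFE (Finset.eq_univ_of_forall h)
      have := (M✶.isFlat_iff_forall_corank_insert_lt hF.subset_ground).1 hF e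
        ⟨by rw [Matroid.dual_ground, hE]; exact Set.mem_univ e, he⟩
      omega
    refine ⟨_, Fᶜ, hpos, ?_, ?_, rfl⟩
    · have h1 := M✶.corank_add_eRk (F : Set E)
      have h2 := M.eRank_add_eRank_dual
      rw [hk, hE, Set.encard_univ, ENat.card_eq_coe_fintype_card, hn] at h2
      have h3 : (k : ℕ∞) + M✶.corank (F : Set E) ≤ n := by
        rw [← h2, ← h1]
        gcongr
        exact le_self_add
      norm_cast at h3
      omega
    · rw [hcirc, compl_compl, Nat.sub_add_cancel hpos]
      exact ⟨hF, rfl⟩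

end SymbolicRees

theorem mainTheorem2 {E : Type*} [Fintype E] [DecidableEq E] (𝕃 : Type*) [Field 𝕃]
    (M : Matroid E) (hE : M.E = Set.univ) (n k : ℕ) (hn : Fintype.card E = n)
    (hk : M.eRank = (k : ℕ∞)) :
    symbolicReesAlgebra (stanleyReisnerIdeal 𝕃 M.independenceComplex) =
        Algebra.adjoin (MvPolynomial E 𝕃)
          {f : Polynomial (MvPolynomial E 𝕃) | ∃ (i : ℕ) (C : Finset E),
            1 ≤ i ∧ i ≤ n - k ∧ (M.elongation (i - 1)).IsCircuit (C : Set E) ∧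
              f = Polynomial.monomial i (squarefreeMonomial 𝕃 C)} ∧
      symbolicReesAlgebra (stanleyReisnerIdeal 𝕃 M.independenceComplex) =
        Algebra.adjoin (MvPolynomial E 𝕃)
          {f : Polynomial (MvPolynomial E 𝕃) | ∃ F : Finset E,
            M✶.IsFlat (F : Set E) ∧ F ≠ Finset.univ ∧
              f = Polynomial.monomial (M✶.corank (F : Set E)) (squarefreeMonomial 𝕃 Fᶜ)} := by
  rw [setOf_elongation_circuit_monomials_eq hE hn hk]
  exact ⟨symbolicReesAlgebra_eq_adjoin_dualFlatMonomials hE,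
    symbolicReesAlgebra_eq_adjoin_dualFlatMonomials hE⟩
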